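/- Let $K$ be a perfect field. For a commutative $K$-algebra $R$ let $G=R[\mathrm{d}^{(k)}r \mid k\ge 1,\ r\in R]$ be the polynomial algebra in the indicated symbols, graded by $\deg \mathrm{d}^{(k)}r=k$, put $\mathrm{d}^{(0)}r:=r$, and let $I\subseteq G$ be the (homogeneous) ideal generated by the elements $$\mathrm{d}^{(k)}(r+s)-\mathrm{d}^{(k)}r-\mathrm{d}^{(k)}s,\qquad \mathrm{d}^{(k)}a,\qquad \mathrm{d}^{(k)}(rs)-\sum_{i=0}^{k}\mathrm{d}^{(i)}r\cdot \mathrm{d}^{(k-i)}s\qquad (k\ge 1,\ r,s\in R,\ a\in K).$$ The algebra of higher differentials $\mathrm{Dif}_{R/K}$ is the completion of the graded algebra $G/I$ with respect to the filtration by the ideals $\bigoplus_{n\ge k}(G/I)_n$; $\varepsilon:\mathrm{Dif}_{R/K}\to(\mathrm{Dif}_{R/K})_0=R$ denotes the projection onto the component of degree $0$, and $\mathrm{d}_R:R\to\mathrm{Dif}_{R/K}$, $\mathrm{d}_R(r)=\sum_{k\ge 0}\mathrm{d}^{(k)}r$, the universal higher derivation, which is a homomorphism of $K$-algebras. A higher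 connection on an $R$-module $M$ is an additive map $\nabla:M\to\mathrm{Dif}_{R/K}\otimes_R M$ with $(\varepsilon\otimes\mathrm{id}_M)\circ\nabla=\mathrm{id}_M$ (identifying $R\otimes_R M=M$) and $\nabla(rm)=\mathrm{d}_R(r)\,\nabla(m)$ for all $r\in R$, $m\in M$; no integrability or iterativity is required. 1. Let $R$ be a finitely generated $K$-algebra which is a regular ring. Then every finitely generated $R$-module that admits a higher connection is projective. 2. Let $(R,\mathfrak m)$ be a regular local ring which is a localisation of a finitely generated $K$-algebra and whose residue field $R/\mathfrak m$ is a finite separable extension of $K$. Then every finitely generated $R$-module that admits a higher connection is free. -/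

import Mathlib

open scoped TensorProduct

noncomputable section

namespace HigherDifferential

/-- The symbol `d⁽ᵏ⁾ r` in the polynomial algebra `G = R[d⁽ᵏ⁾ r | k ≥ 1, r ∈ R]`,
with the convention `d⁽⁰⁾ r = r`. -/
def symb {R : Type*} [CommRing R] (k : ℕ) (r : R) : MvPolynomial (ℕ+ × R) R :=
  if h : 0 < k then MvPolynomial.X (⟨k, h⟩, r) else MvPolynomial.C r

/-- The ideal `I` of `G` generated by the relations of a higher derivation over `K`:
additivity, vanishing on constants, and the Leibniz rule. -/
def relations (K R : Type*) [Field K] [CommRing R] [Algebra K R] :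
    Ideal (MvPolynomial (ℕ+ × R) R) :=
  Ideal.span
    ({p | ∃ (k : ℕ) (r s : R), 0 < k ∧ p = symb k (r + s) - symb k r - symb k s} ∪
     {p | ∃ (k : ℕ) (a : K), 0 < k ∧ p = symb k (algebraMap K R a)} ∪
     {p | ∃ (k : ℕ) (r s : R), 0 < k ∧
        p = symb k (r * s) - ∑ i ∈ Finset.range (k + 1), symb i r * symb (k - i) s})

/-- The graded algebra `G / I`. -/
def GradedDif (K R : Type*) [Field K] [CommRing R] [Algebra K R] : Type _ :=
  MvPolynomial (ℕ+ × R) R ⧸ relations K R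

instance (K R : Type*) [Field K] [CommRing R] [Algebra K R] : CommRing (GradedDif K R) :=
  inferInstanceAs (CommRing (MvPolynomial (ℕ+ × R) R ⧸ relations K R))

instance (K R : Type*) [Field K] [CommRing R] [Algebra K R] : Algebra R (GradedDif K R) :=
  inferInstanceAs (Algebra R (MvPolynomial (ℕ+ × R) R ⧸ relations K R))

/-- The quotient map `G → G / I`. -/
def toGradedDif (K R : Type*) [Field K] [CommRing R] [Algebra K R] :
    MvPolynomial (ℕ+ × R) R →ₐ[R] GradedDif K R :=
  Ideal.Quotient.mkₐ R (relations K R)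

/-- The `n`-th homogeneous component of `G / I`, where `d⁽ᵏ⁾ r` has degree `k`. -/
def component (K R : Type*) [Field K] [CommRing R] [Algebra K R] (n : ℕ) :
    Submodule R (GradedDif K R) :=
  (MvPolynomial.weightedHomogeneousSubmodule R (fun v : ℕ+ × R => (v.1 : ℕ)) n).map
    (toGradedDif K R).toLinearMap

/-- The ideal `⨁_{n ≥ k} (G / I)ₙ` of `G / I`. -/
def filtration (K R : Type*) [Field K] [CommRing R] [Algebra K R] (k : ℕ) :
    Ideal (GradedDif K R) :=
  Ideal.span {x | ∃ n, k ≤ n ∧ x ∈ component K R n}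

theorem filtration_anti (K R : Type*) [Field K] [CommRing R] [Algebra K R] {k l : ℕ}
    (h : k ≤ l) : filtration K R l ≤ filtration K R k :=
  Ideal.span_mono fun _ ⟨n, hn, hx⟩ => ⟨n, h.trans hn, hx⟩

/-- The algebra of higher differentials as a subalgebra of a product: the completion of the graded algebra `G / I`
with respect to the degree filtration, i.e. the inverse limit of the quotients of `G / I` by
the ideals `⨁_{n ≥ k} (G / I)ₙ`. -/
def difSubalgebra (K R : Type*) [Field K] [CommRing R] [Algebra K R] :
    Subalgebra R (∀ k : ℕ, GradedDif K R ⧸ filtration K R k) where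
  carrier := {x | ∀ (k l : ℕ) (h : k ≤ l),
    Ideal.Quotient.factor (filtration_anti K R h) (x l) = x k}
  mul_mem' hx hy k l h := by simp [hx k l h, hy k l h]
  add_mem' hx hy k l h := by simp [hx k l h, hy k l h]
  algebraMap_mem' _ _ _ _ := rfl

/-- The algebra of higher differentials `Dif_{R/K}`. -/
def Dif (K R : Type*) [Field K] [CommRing R] [Algebra K R] : Type _ :=
  difSubalgebra K R

instance (K R : Type*) [Field K] [CommRing R] [Algebra K R] : CommRing (Dif K R) :=
  inferInstanceAs (CommRing (difSubalgebra K R))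

instance (K R : Type*) [Field K] [CommRing R] [Algebra K R] : Algebra R (Dif K R) :=
  inferInstanceAs (Algebra R (difSubalgebra K R))

instance (K R : Type*) [Field K] [CommRing R] [Algebra K R] : Algebra K (Dif K R) :=
  ((algebraMap R (Dif K R)).comp (algebraMap K R)).toAlgebra

instance (K R : Type*) [Field K] [CommRing R] [Algebra K R] : IsScalarTower K R (Dif K R) :=
  IsScalarTower.of_algebraMap_eq fun _ => rfl

/-- The class of `d⁽ᵏ⁾ r` in `G / I`. -/
def cls (K : Type*) {R : Type*} [Field K] [CommRing R] [Algebra K R] (k : ℕ) (r : R) :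
    GradedDif K R :=
  toGradedDif K R (symb k r)

theorem cls_zero (K : Type*) {R : Type*} [Field K] [CommRing R] [Algebra K R] (r : R) :
    cls K 0 r = algebraMap R (GradedDif K R) r := rfl

theorem cls_add (K : Type*) {R : Type*} [Field K] [CommRing R] [Algebra K R] (k : ℕ) (r s : R) :
    cls K k (r + s) = cls K k r + cls K k s := by
  rcases Nat.eq_zero_or_pos k with rfl | hk
  · simp [cls_zero]
  · rw [← sub_eq_zero, ← sub_sub]
    exact Ideal.Quotient.eq_zero_iff_mem.mpr
      (Ideal.subset_span (Or.inl (Or.inl ⟨k, r, s, hk, rfl⟩)))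

theorem cls_const (K : Type*) {R : Type*} [Field K] [CommRing R] [Algebra K R] (k : ℕ)
    (hk : 0 < k) (a : K) : cls K k (algebraMap K R a) = 0 :=
  Ideal.Quotient.eq_zero_iff_mem.mpr (Ideal.subset_span (Or.inl (Or.inr ⟨k, a, hk, rfl⟩)))

theorem cls_mul (K : Type*) {R : Type*} [Field K] [CommRing R] [Algebra K R] (k : ℕ) (r s : R) :
    cls K k (r * s) = ∑ i ∈ Finset.range (k + 1), cls K i r * cls K (k - i) s := by
  rcases Nat.eq_zero_or_pos k with rfl | hk
  · simp [cls_zero]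
  · have h : toGradedDif K R
        (symb k (r * s) - ∑ i ∈ Finset.range (k + 1), symb i r * symb (k - i) s) = 0 :=
      Ideal.Quotient.eq_zero_iff_mem.mpr (Ideal.subset_span (Or.inr ⟨k, r, s, hk, rfl⟩))
    rw [map_sub, sub_eq_zero, map_sum] at h
    simpa [cls] using h

theorem cls_mem_component (K : Type*) {R : Type*} [Field K] [CommRing R] [Algebra K R] (k : ℕ)
    (r : R) : cls K k r ∈ component K R k := by
  refine ⟨symb k r, ?_, rfl⟩
  change MvPolynomial.IsWeightedHomogeneous _ _ _
  unfold symb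
  split_ifs with h
  · exact MvPolynomial.isWeightedHomogeneous_X R _ _
  · obtain rfl : k = 0 := by omega
    exact MvPolynomial.isWeightedHomogeneous_C _ r

theorem cls_mem_filtration (K : Type*) {R : Type*} [Field K] [CommRing R] [Algebra K R]
    {k n : ℕ} (h : k ≤ n) (r : R) : cls K n r ∈ filtration K R k :=
  Ideal.subset_span ⟨n, h, cls_mem_component K n r⟩

theorem cls_mul_mem_filtration (K : Type*) {R : Type*} [Field K] [CommRing R] [Algebra K R]
    {k i j : ℕ} (h : k ≤ i + j) (r s : R) : cls K i r * cls K j s ∈ filtration K R k := by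
  obtain ⟨p, hp, hp'⟩ := cls_mem_component K i r
  obtain ⟨q, hq, hq'⟩ := cls_mem_component K j s
  refine Ideal.subset_span ⟨i + j, h, p * q, MvPolynomial.IsWeightedHomogeneous.mul hp hq, ?_⟩
  rw [← hp', ← hq']
  exact map_mul (toGradedDif K R) p q

/-- The partial sum `∑_{i < k} d⁽ⁱ⁾ r` in `G / I`. -/
def dPartial (K : Type*) {R : Type*} [Field K] [CommRing R] [Algebra K R] (k : ℕ) (r : R) :
    GradedDif K R :=
  ∑ i ∈ Finset.range k, cls K i r

/-- The series `∑ᵢ d⁽ⁱ⁾ r` as an element of the completion. -/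
def dFun (K : Type*) {R : Type*} [Field K] [CommRing R] [Algebra K R] (r : R) : Dif K R :=
  ⟨fun k => Ideal.Quotient.mk (filtration K R k) (dPartial K k r), fun k l h => by
    rw [Ideal.Quotient.factor_mk, Ideal.Quotient.mk_eq_mk_iff_sub_mem]
    unfold dPartial
    rw [← Finset.sum_range_add_sum_Ico _ h, add_sub_cancel_left]
    exact Ideal.sum_mem _ fun i hi => cls_mem_filtration K (Finset.mem_Ico.mp hi).1 r⟩

theorem dPartial_mul_sub_mem (K : Type*) {R : Type*} [Field K] [CommRing R] [Algebra K R]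
    (k : ℕ) (r s : R) :
    dPartial K k (r * s) - dPartial K k r * dPartial K k s ∈ filtration K R k := by
  have h1 : dPartial K k (r * s) =
      ∑ p ∈ (Finset.range k ×ˢ Finset.range k).filter (fun p => p.1 + p.2 < k),
        cls K p.1 r * cls K p.2 s := by
    unfold dPartial
    simp_rw [cls_mul, Finset.sum_sigma']
    refine Finset.sum_bij' (fun x _ => (x.2, x.1 - x.2)) (fun p _ => ⟨p.1 + p.2, p.1⟩)
      ?_ ?_ ?_ ?_ ?_
    · intro x hx
      simp only [Finset.mem_sigma, Finset.mem_range, Finset.mem_filter, Finset.mem_product] at *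
      omega
    · intro x hx
      simp only [Finset.mem_sigma, Finset.mem_range, Finset.mem_filter, Finset.mem_product] at *
      omega
    · rintro ⟨a, b⟩ hx
      simp only [Finset.mem_sigma, Finset.mem_range] at hx
      have : b + (a - b) = a := by omega
      simp [this]
    · intro x hx
      simp
    · intro x hx
      rfl
  have h2 : dPartial K k r * dPartial K k s =
      ∑ p ∈ Finset.range k ×ˢ Finset.range k, cls K p.1 r * cls K p.2 s := by
    unfold dPartial
    rw [Finset.sum_mul_sum, Finset.sum_product]
  rw [h1, h2, ← Finset.sum_filter_add_sum_filter_not (Finset.range k ×ˢ Finset.range k)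
    (fun p => p.1 + p.2 < k), sub_add_cancel_left]
  refine neg_mem (Ideal.sum_mem _ fun p hp => ?_)
  exact cls_mul_mem_filtration K (not_lt.mp (Finset.mem_filter.mp hp).2) r s

theorem dFun_const (K : Type*) {R : Type*} [Field K] [CommRing R] [Algebra K R] (a : K) :
    dFun K (algebraMap K R a) = algebraMap R (Dif K R) (algebraMap K R a) := by
  refine Subtype.ext ?_
  funext k
  change Ideal.Quotient.mk (filtration K R k) (dPartial K k (algebraMap K R a)) =
    Ideal.Quotient.mk (filtration K R k) (algebraMap R (GradedDif K R) (algebraMap K R a))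
  rw [← cls_zero K]
  rcases Nat.eq_zero_or_pos k with rfl | hk
  · rw [Ideal.Quotient.mk_eq_mk_iff_sub_mem]
    refine sub_mem (by simp [dPartial]) (cls_mem_filtration K le_rfl _)
  · obtain ⟨n, rfl⟩ : ∃ n, k = n + 1 := ⟨k - 1, by omega⟩
    unfold dPartial
    rw [Finset.sum_range_succ', Finset.sum_eq_zero, zero_add]
    exact fun i _ => cls_const K (i + 1) (Nat.succ_pos i) a

/-- The universal higher derivation `d_R : R → Dif_{R/K}`, `r ↦ ∑ᵢ d⁽ⁱ⁾ r`, a homomorphism of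
`K`-algebras. -/
def d (K R : Type*) [Field K] [CommRing R] [Algebra K R] : R →ₐ[K] Dif K R where
  toFun := dFun K
  map_one' := by
    have h := dFun_const K (R := R) 1
    rwa [map_one, map_one] at h
  map_zero' := by
    have h := dFun_const K (R := R) 0
    rwa [map_zero, map_zero] at h
  map_add' r s := by
    refine Subtype.ext ?_
    funext k
    change Ideal.Quotient.mk (filtration K R k) (dPartial K k (r + s)) =
      Ideal.Quotient.mk (filtration K R k) (dPartial K k r) +
        Ideal.Quotient.mk (filtration K R k) (dPartial K k s)
    rw [← map_add]
    simp only [dPartial, cls_add, Finset.sum_add_distrib]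
  map_mul' r s := by
    refine Subtype.ext ?_
    funext k
    change Ideal.Quotient.mk (filtration K R k) (dPartial K k (r * s)) =
      Ideal.Quotient.mk (filtration K R k) (dPartial K k r) *
        Ideal.Quotient.mk (filtration K R k) (dPartial K k s)
    rw [← map_mul, Ideal.Quotient.mk_eq_mk_iff_sub_mem]
    exact dPartial_mul_sub_mem K k r s
  commutes' a := dFun_const K a

/-- The augmentation `G / I → R` onto the component of degree `0`, `d⁽ᵏ⁾ r ↦ 0` for `k ≥ 1`. -/
def gradedAug (K R : Type*) [Field K] [CommRing R] [Algebra K R] : GradedDif K R →ₐ[R] R :=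
  Ideal.Quotient.liftₐ (relations K R) (MvPolynomial.aeval fun _ => (0 : R)) (by
    have hs : ∀ (k : ℕ) (r : R), 0 < k →
        MvPolynomial.aeval (fun _ : ℕ+ × R => (0 : R)) (symb k r) = 0 := by
      intro k r hk
      simp [symb, hk]
    intro a ha
    have hle : relations K R ≤
        RingHom.ker (MvPolynomial.aeval (fun _ : ℕ+ × R => (0 : R)) :
          MvPolynomial (ℕ+ × R) R →ₐ[R] R) := by
      refine Ideal.span_le.mpr ?_
      rintro p ((⟨k, r, s, hk, rfl⟩ | ⟨k, a, hk, rfl⟩) | ⟨k, r, s, hk, rfl⟩)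
      · simp only [SetLike.mem_coe, RingHom.mem_ker, map_sub, hs _ _ hk, sub_zero]
      · simp only [SetLike.mem_coe, RingHom.mem_ker, hs _ _ hk]
      · simp only [SetLike.mem_coe, RingHom.mem_ker, map_sub, map_sum, map_mul, hs _ _ hk,
          zero_sub, neg_eq_zero]
        refine Finset.sum_eq_zero fun i hi => ?_
        rcases Nat.eq_zero_or_pos i with rfl | hi'
        · rw [Nat.sub_zero, hs _ _ hk, mul_zero]
        · rw [hs _ _ hi', zero_mul]
    exact hle ha)

theorem gradedAug_filtration (K R : Type*) [Field K] [CommRing R] [Algebra K R]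
    (x : GradedDif K R) (hx : x ∈ filtration K R 1) : gradedAug K R x = 0 := by
  have hle : filtration K R 1 ≤ RingHom.ker (gradedAug K R) := by
    refine Ideal.span_le.mpr ?_
    rintro _ ⟨n, hn, p, hp, rfl⟩
    change MvPolynomial.aeval (fun _ : ℕ+ × R => (0 : R)) p = 0
    have hc : MvPolynomial.coeff 0 p = 0 := by
      by_contra hne
      have h0 : Finsupp.weight (fun v : ℕ+ × R => (v.1 : ℕ)) 0 = n := hp hne
      rw [map_zero] at h0
      omega
    rw [← MvPolynomial.constantCoeff_eq] at hc
    have := MvPolynomial.aeval_zero (S₁ := R) p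
    rw [hc, map_zero] at this
    exact this
  exact hle hx

/-- The augmentation `ε : Dif_{R/K} → (Dif_{R/K})₀ = R`. -/
def aug (K R : Type*) [Field K] [CommRing R] [Algebra K R] : Dif K R →ₐ[R] R :=
  ((Ideal.Quotient.liftₐ (filtration K R 1) (gradedAug K R) (gradedAug_filtration K R)).comp
    (Pi.evalAlgHom R (fun k : ℕ => GradedDif K R ⧸ filtration K R k) 1)).comp
    (difSubalgebra K R).val

/-- A higher connection on an `R`-module `M`: an additive map `∇ : M → Dif_{R/K} ⊗_R M` with
`(ε ⊗ id) ∘ ∇ = id` (under `R ⊗_R M = M`) and `∇(r m) = d_R(r) ∇(m)`. -/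
structure HigherConnection (K R M : Type*) [Field K] [CommRing R] [Algebra K R]
    [AddCommGroup M] [Module R M] where
  /-- The underlying additive map. -/
  toAddHom : M →+ Dif K R ⊗[R] M
  aug_apply : ∀ m : M, (aug K R).toLinearMap.rTensor M (toAddHom m) = (1 : R) ⊗ₜ[R] m
  map_smul : ∀ (r : R) (m : M), toAddHom (r • m) = d K R r • toAddHom m

end HigherDifferential

end

/-! A higher connection is a formal parallel transport: it spreads a functional on the fibre of `M`
at a point over every infinitesimal neighbourhood of that point.

Let `A` be a regular local `R`-algebra with residue field `k` separable over `K`, and put `T = A ⧸ m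
^ N`. Since `k` lifts into `T` and a regular system of parameters is quasi-regular, `T` is a
truncated polynomial ring over `k` (`IsRegularLocalRing.exists_truncatedPresentation`), hence
graded. Sending `d⁽ⁱ⁾ r` to the degree `i` part of the image of `r` defines a ring map `Dif K R →
T`. It carries `d K R r` to the image of `r` in `T`, while scalars from `R` act through `k`.
Composing it with the connection lifts each linear `l : M → k` to a semilinear `L : M → T`
(`TruncatedPresentation.exists_semilinear_lift`).

Take elements of `M` forming a basis of `k ⊗ M`; by Nakayama they generate `A ⊗ M`. The lifts of the
dual basis, evaluated on them, form a matrix that is the identity modulo the maximal ideal, hence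
invertible over `T`. So the coefficients of any relation lie in `m ^ N` for all `N` and vanish by
Krull's intersection theorem. Both claims follow from `HigherConnection.free_baseChange`. -/

/-! ### Quasi-regularity of a regular system of parameters. -/

theorem MvPolynomial.IsHomogeneous.eval_mul_left {σ A : Type*} [CommRing A]
    {F : MvPolynomial σ A} {d : ℕ} (hF : F.IsHomogeneous d) (a : A) (c : σ → A) :
    MvPolynomial.eval (fun i => a * c i) F = a ^ d * MvPolynomial.eval c F := by
  rw [MvPolynomial.eval_eq, MvPolynomial.eval_eq, Finset.mul_sum]
  refine Finset.sum_congr rfl fun e he => ?_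
  have hd := hF (MvPolynomial.mem_support_iff.mp he)
  rw [Finsupp.weight_apply] at hd
  simp only [Finsupp.sum, Pi.one_apply, smul_eq_mul, mul_one] at hd
  simp only [mul_pow, Finset.prod_mul_distrib, Finset.prod_pow_eq_pow_sum, hd]
  ring

-- Over an infinite field a nonzero form has a point `c` where it does not vanish. Cutting `A` by
-- the `n - 1` equations that make `x` proportional to `c` makes the maximal ideal nilpotent in the
-- quotient, so Krull's height theorem bounds the dimension by `n - 1`.
open IsLocalRing in
theorem IsLocalRing.map_residue_eq_zero_of_eval_mem_of_infinite {A : Type*} [CommRing A]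
    [IsLocalRing A] [IsNoetherianRing A] [Infinite (ResidueField A)] {n : ℕ} (x : Fin n → A)
    (hx : Ideal.span (Set.range x) = maximalIdeal A) (hn : (n : WithBot ℕ∞) ≤ ringKrullDim A)
    {F : MvPolynomial (Fin n) A} {d : ℕ} (hF : F.IsHomogeneous d)
    (h : MvPolynomial.eval x F ∈ maximalIdeal A ^ (d + 1)) :
    MvPolynomial.map (residue A) F = 0 := by
  by_contra hne
  obtain ⟨c', hc'⟩ : ∃ c, MvPolynomial.eval c (MvPolynomial.map (residue A) F) ≠ 0 := by
    by_contra! H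
    exact hne (MvPolynomial.funext fun c => by simp [H c])
  obtain ⟨c, rfl⟩ : ∃ c : Fin n → A, c' = residue A ∘ c :=
    ⟨fun i => (residue_surjective (c' i)).choose,
      funext fun i => ((residue_surjective (c' i)).choose_spec).symm⟩
  have hFc : IsUnit (MvPolynomial.eval c F) := by
    rwa [← residue_ne_zero_iff_isUnit, MvPolynomial.eval₂_comp, ← MvPolynomial.eval_map]
  -- Degree zero is separate: a constant form need not vanish at the origin, so `c` might have no
  -- unit coordinate.
  rcases Nat.eq_zero_or_pos d with rfl | hd
  · obtain ⟨a, rfl⟩ : ∃ a, F = MvPolynomial.C a :=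
      ⟨_, MvPolynomial.totalDegree_eq_zero_iff_eq_C.mp (Nat.le_zero.mp hF.totalDegree_le)⟩
    simp only [MvPolynomial.eval_C, zero_add, pow_one] at h hFc
    exact (mem_maximalIdeal _).mp h hFc
  obtain ⟨j, hj⟩ : ∃ j, IsUnit (c j) := by
    by_contra! H
    refine (mem_maximalIdeal (MvPolynomial.eval c F)).mp ?_ hFc
    have h0 : residue A ∘ c = 0 := funext fun i => (residue_eq_zero_iff _).mpr (H i)
    rw [← residue_eq_zero_iff, MvPolynomial.eval₂_comp, ← MvPolynomial.eval_map, h0,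
      MvPolynomial.eval_zero, MvPolynomial.constantCoeff_eq]
    exact (hF.map _).coeff_eq_zero (by simpa using hd.ne)
  obtain ⟨v, hv⟩ := hj.exists_left_inv
  -- Modulo the `y i`, the vector `x` equals `v * x j` times `c`.
  let y : Fin n → A := fun i => x i - c i * v * x j
  have hyj : y j = 0 := by simp [y, mul_comm (c j), hv]
  let I : Ideal A := Ideal.span (y '' {j}ᶜ)
  have hyI : ∀ i, y i ∈ I := by
    intro i
    by_cases hi : i = j
    · rw [hi, hyj]; exact I.zero_mem
    · exact Ideal.subset_span ⟨i, hi, rfl⟩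
  have hxI : ∀ i, Ideal.Quotient.mk I (x i) = Ideal.Quotient.mk I (c i) *
      Ideal.Quotient.mk I (v * x j) := by
    intro i
    rw [← map_mul, Ideal.Quotient.mk_eq_mk_iff_sub_mem, ← mul_assoc]
    exact hyI i
  have hm : (maximalIdeal A).map (Ideal.Quotient.mk I) =
      Ideal.span {Ideal.Quotient.mk I (v * x j)} := by
    rw [← hx, Ideal.map_span]
    refine le_antisymm (Ideal.span_le.mpr ?_) (Ideal.span_le.mpr ?_)
    · rintro _ ⟨_, ⟨i, rfl⟩, rfl⟩
      exact Ideal.mem_span_singleton.mpr ⟨_, (hxI i).trans (mul_comm _ _)⟩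
    · rintro _ rfl
      rw [map_mul]
      exact Ideal.mul_mem_left _ _ (Ideal.subset_span ⟨_, ⟨j, rfl⟩, rfl⟩)
  have hIle : I ≤ maximalIdeal A := by
    refine Ideal.span_le.mpr ?_
    rintro _ ⟨i, -, rfl⟩
    have : ∀ i, x i ∈ maximalIdeal A := fun i => hx ▸ Ideal.subset_span ⟨i, rfl⟩
    exact sub_mem (this i) (Ideal.mul_mem_left _ _ (this j))
  -- Modulo `I`, the value of `F` at `x` is the unit `F(c)` times `(v * x j) ^ d`, yet it is
  -- divisible by `(v * x j) ^ (d + 1)`. The difference of the two coefficients is still a unit, so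
  -- the power itself vanishes.
  have hpow : (v * x j) ^ d ∈ I := by
    have h1 : Ideal.Quotient.mk I (MvPolynomial.eval x F) =
        Ideal.Quotient.mk I (MvPolynomial.eval c F) * Ideal.Quotient.mk I (v * x j) ^ d := by
      have e1 : Ideal.Quotient.mk I (MvPolynomial.eval x F) =
          Ideal.Quotient.mk I (MvPolynomial.eval (fun i => v * x j * c i) F) := by
        rw [MvPolynomial.eval₂_comp, MvPolynomial.eval₂_comp]
        congr 1
        funext i
        simp only [Function.comp]
        rw [hxI, map_mul _ _ (c i), mul_comm]
      rw [e1, hF.eval_mul_left, map_mul, map_pow, mul_comm]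
    have h2 := Ideal.mem_map_of_mem (Ideal.Quotient.mk I) h
    rw [Ideal.map_pow, hm, Ideal.span_singleton_pow, h1, Ideal.mem_span_singleton] at h2
    obtain ⟨r', hr⟩ := h2
    obtain ⟨r, rfl⟩ := Ideal.Quotient.mk_surjective r'
    rw [← map_pow, ← map_pow, ← map_mul, ← map_mul, Ideal.Quotient.mk_eq_mk_iff_sub_mem,
      pow_succ, mul_assoc, mul_comm (MvPolynomial.eval c F), ← mul_sub] at hr
    have hu : IsUnit (MvPolynomial.eval c F - v * x j * r) := by
      by_contra hu
      refine (mem_maximalIdeal _).mp ?_ hFc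
      have hxj : x j ∈ maximalIdeal A := hx ▸ Ideal.subset_span ⟨j, rfl⟩
      have := add_mem ((mem_maximalIdeal _).mpr hu)
        (Ideal.mul_mem_right r _ (Ideal.mul_mem_left _ v hxj))
      rwa [sub_add_cancel] at this
    exact (Ideal.mul_unit_mem_iff_mem I hu).mp hr
  have hmin : maximalIdeal A ∈ I.minimalPrimes := by
    refine ⟨⟨inferInstance, hIle⟩, fun P ⟨hP, hIP⟩ _ => ?_⟩
    rw [← hx, Ideal.span_le]
    rintro _ ⟨i, rfl⟩
    have h3 : v * x j ∈ P := hP.mem_of_pow_mem d (hIP hpow)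
    have h4 := add_mem (hIP (hyI i)) (Ideal.mul_mem_left P (c i) h3)
    simpa [y, mul_assoc] using h4
  have hht := Ideal.height_le_spanRank_toENat_of_mem_minimalPrimes I _ hmin
  -- The index `j`, where `y` is zero, is left out, which saves one generator.
  have hcard : I.spanRank ≤ (n - 1 : ℕ) := by
    refine (Submodule.spanRank_span_le_card _).trans ?_
    have := Cardinal.mk_image_le_lift (f := y) (s := {j}ᶜ)
    rw [← Cardinal.lift_le.{0}]
    refine this.trans ?_
    have hj' : (Finset.univ.filter fun i => ¬ i = j) = Finset.univ.erase j := by ext; simp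
    simp [Cardinal.mk_fintype, hj']
  have hht' : (maximalIdeal A).height ≤ (n - 1 : ℕ) := by
    refine hht.trans ?_
    have := Cardinal.toENat.monotone' hcard
    simpa using this
  rw [← maximalIdeal_height_eq_ringKrullDim] at hn
  have hn' : (n : ℕ∞) ≤ (maximalIdeal A).height := by exact_mod_cast hn
  have : n ≤ n - 1 := by exact_mod_cast hn'.trans hht'
  have := j.pos
  omega

-- Localising `A[X]` at the extension of the maximal ideal makes the residue field infinite, while
-- the parameters still generate the maximal ideal and its height is unchanged.
open IsLocalRing Polynomial in
theorem IsLocalRing.map_residue_eq_zero_of_eval_mem {A : Type*} [CommRing A]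
    [IsLocalRing A] [IsNoetherianRing A] {n : ℕ} (x : Fin n → A)
    (hx : Ideal.span (Set.range x) = maximalIdeal A) (hn : (n : WithBot ℕ∞) ≤ ringKrullDim A)
    {F : MvPolynomial (Fin n) A} {d : ℕ} (hF : F.IsHomogeneous d)
    (h : MvPolynomial.eval x F ∈ maximalIdeal A ^ (d + 1)) :
    MvPolynomial.map (residue A) F = 0 := by
  let q : Ideal A[X] := (maximalIdeal A).map C
  have hq : q.IsPrime := Ideal.isPrime_map_C_of_isPrime
  let B := Localization.AtPrime q
  let f : A →+* B := algebraMap A B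
  have hf : f = (algebraMap A[X] B).comp C := IsScalarTower.algebraMap_eq A A[X] B
  have hmap : (maximalIdeal A).map f = maximalIdeal B := by
    rw [hf, ← Ideal.map_map]
    exact Localization.AtPrime.map_eq_maximalIdeal
  have hmem : ∀ p : A[X], residue B (algebraMap A[X] B p) = 0 ↔ ∀ i, p.coeff i ∈ maximalIdeal A :=
    fun p => by
    rw [residue_eq_zero_iff, IsLocalization.AtPrime.to_map_mem_maximal_iff B q, Ideal.mem_map_C_iff]
  have : Infinite (ResidueField B) := by
    refine Infinite.of_injective (fun i : ℕ => residue B (algebraMap A[X] B (X ^ i))) ?_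
    intro i j hij
    by_contra hne
    have h0 := (hmem (X ^ i - X ^ j)).mp (by rw [map_sub, map_sub, sub_eq_zero]; exact hij) i
    rw [coeff_sub, coeff_X_pow_self, coeff_X_pow, if_neg hne, sub_zero] at h0
    exact (Ideal.ne_top_iff_one _).mp (maximalIdeal.isMaximal A).ne_top h0
  have hdim : (n : WithBot ℕ∞) ≤ ringKrullDim B := by
    rw [IsLocalization.AtPrime.ringKrullDim_eq_height q B, Polynomial.height_map_C,
      maximalIdeal_height_eq_ringKrullDim]
    exact hn
  have key := map_residue_eq_zero_of_eval_mem_of_infinite (f ∘ x)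
    (by rw [Set.range_comp, ← Ideal.map_span, hx, hmap]) hdim (hF.map f) (by
      rw [MvPolynomial.eval_map, ← MvPolynomial.eval₂_comp, ← hmap, ← Ideal.map_pow]
      exact Ideal.mem_map_of_mem f h)
  ext e
  have := congr_arg (MvPolynomial.coeff e) key
  rw [MvPolynomial.coeff_map, MvPolynomial.coeff_map, MvPolynomial.coeff_zero, hf,
    RingHom.comp_apply, hmem] at this
  rw [MvPolynomial.coeff_map, MvPolynomial.coeff_zero, residue_eq_zero_iff]
  simpa using this 0

/-! ### Truncations of regular local rings as truncated polynomial rings. -/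

/-- A presentation of a `K`-algebra `T` as a truncated polynomial ring over `k`: the polynomials
killed are those whose terms have degree at least `N`. -/
structure TruncatedPresentation (K k σ T : Type*) [CommRing K] [CommRing k] [Algebra K k]
    [CommRing T] [Algebra K T] (N : ℕ) where
  toAlgHom : MvPolynomial σ k →ₐ[K] T
  surjective : Function.Surjective toAlgHom
  map_homogeneous : ∀ (d : ℕ) (f : MvPolynomial σ k), N ≤ d → f.IsHomogeneous d → toAlgHom f = 0
  component_eq_zero : ∀ f : MvPolynomial σ k, toAlgHom f = 0 →
    ∀ d < N, MvPolynomial.homogeneousComponent d f = 0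

theorem MvPolynomial.IsHomogeneous.eval₂_mem_pow {σ A T : Type*} [CommRing A] [CommRing T]
    {F : MvPolynomial σ A} {d : ℕ} (hF : F.IsHomogeneous d) (f : A →+* T) {x : σ → T}
    {I : Ideal T} (hx : ∀ i, x i ∈ I) : MvPolynomial.eval₂ f x F ∈ I ^ d := by
  rw [MvPolynomial.eval₂_eq]
  refine Ideal.sum_mem _ fun e he => Ideal.mul_mem_left _ _ ?_
  have hd := hF (MvPolynomial.mem_support_iff.mp he)
  rw [Finsupp.weight_apply] at hd
  simp only [Finsupp.sum, Pi.one_apply, smul_eq_mul, mul_one] at hd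
  rw [← hd, ← Finset.prod_pow_eq_pow_sum]
  exact Ideal.prod_mem_prod fun i _ => Ideal.pow_mem_pow (hx i) _

/-- Used to trade coefficients in `A` for their residues lifted back into the quotient: the error
has one order more than the form. -/
theorem MvPolynomial.IsHomogeneous.eval₂_sub_eval₂_mem_pow {σ A T : Type*} [CommRing A]
    [CommRing T] {F : MvPolynomial σ A} {d : ℕ} (hF : F.IsHomogeneous d) (f g : A →+* T)
    {x : σ → T} {I : Ideal T} (hx : ∀ i, x i ∈ I) (hfg : ∀ a, f a - g a ∈ I) :
    MvPolynomial.eval₂ f x F - MvPolynomial.eval₂ g x F ∈ I ^ (d + 1) := by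
  rw [MvPolynomial.eval₂_eq, MvPolynomial.eval₂_eq, ← Finset.sum_sub_distrib]
  refine Ideal.sum_mem _ fun e he => ?_
  have hd := hF (MvPolynomial.mem_support_iff.mp he)
  rw [Finsupp.weight_apply] at hd
  simp only [Finsupp.sum, Pi.one_apply, smul_eq_mul, mul_one] at hd
  rw [← sub_mul, pow_succ', ← hd, ← Finset.prod_pow_eq_pow_sum]
  exact Ideal.mul_mem_mul (hfg _) (Ideal.prod_mem_prod fun i _ => Ideal.pow_mem_pow (hx i) _)

theorem MvPolynomial.IsHomogeneous.exists_map_eq {σ A B : Type*} [CommRing A] [CommRing B]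
    {f : A →+* B} (hf : Function.Surjective f) {p : MvPolynomial σ B} {d : ℕ}
    (hp : p.IsHomogeneous d) :
    ∃ F : MvPolynomial σ A, F.IsHomogeneous d ∧ MvPolynomial.map f F = p := by
  choose g hg using hf
  refine ⟨∑ e ∈ p.support, MvPolynomial.monomial e (g (p.coeff e)), ?_, ?_⟩
  · refine MvPolynomial.IsHomogeneous.sum _ _ _ fun e he => ?_
    refine MvPolynomial.isHomogeneous_monomial _ ?_
    rw [← hp (MvPolynomial.mem_support_iff.mp he), Finsupp.degree_eq_weight_one]
    rfl
  · rw [map_sum]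
    simp_rw [MvPolynomial.map_monomial, hg]
    exact p.support_sum_monomial_coeff

-- A coefficient field exists because separability makes `k` formally étale over `K`; mapping the
-- variables to a regular system of parameters is then onto by successive approximation.
-- Quasi-regularity prevents any kernel below degree `N`.
open IsLocalRing in
theorem IsRegularLocalRing.exists_truncatedPresentation (K A : Type*) [Field K] [CommRing A]
    [Algebra K A] [IsRegularLocalRing A] [Algebra.IsSeparable K (ResidueField A)] (N : ℕ)
    (hN : 0 < N) :
    ∃ (n : ℕ) (P : TruncatedPresentation K (ResidueField A) (Fin n) (A ⧸ maximalIdeal A ^ N) N)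
      (q : A ⧸ maximalIdeal A ^ N →ₐ[K] ResidueField A),
      (∀ a, q (Ideal.Quotient.mk _ a) = residue A a) ∧
        ∀ f, q (P.toAlgHom f) = f.constantCoeff := by
  let m := maximalIdeal A
  let T := A ⧸ m ^ N
  let n := m.spanFinrank
  have hfg : m.FG := m.fg_of_isNoetherianRing
  obtain ⟨x, hx⟩ : ∃ x : Fin n → A, Ideal.span (Set.range x) = m := by
    have hfin := Submodule.FG.finite_generators hfg
    have hc : m.generators.ncard = n := Submodule.FG.generators_ncard hfg
    let e := hfin.equivFinOfCardEq hc
    refine ⟨fun i => (e.symm i : A), ?_⟩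
    rw [show (fun i => (e.symm i : A)) = Subtype.val ∘ e.symm from rfl, Set.range_comp,
      e.symm.surjective.range_eq, Set.image_univ, Subtype.range_coe]
    exact m.span_generators
  have hn : (n : WithBot ℕ∞) ≤ ringKrullDim A :=
    (IsRegularLocalRing.spanFinrank_maximalIdeal (R := A)).le
  let J : Ideal T := m.map (Ideal.Quotient.mk (m ^ N))
  have hJ : ∀ i a, i ≤ N → (Ideal.Quotient.mk (m ^ N) a ∈ J ^ i ↔ a ∈ m ^ i) := fun i a hi => by
    rw [← Ideal.map_pow, ← Ideal.mem_comap, Ideal.comap_map_of_surjective _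
      Ideal.Quotient.mk_surjective, ← RingHom.ker_eq_comap_bot, Ideal.mk_ker,
      sup_eq_left.mpr (Ideal.pow_le_pow_right hi)]
  have hJN : J ^ N = ⊥ := by
    rw [← Ideal.map_pow, Ideal.map_quotient_self]
  let q : T →ₐ[K] ResidueField A := Ideal.Quotient.liftₐ (m ^ N)
    (IsScalarTower.toAlgHom K A (ResidueField A)) (fun a ha => by
      exact (residue_eq_zero_iff a).mpr (Ideal.pow_le_self hN.ne' ha))
  have hqmk : ∀ a, q (Ideal.Quotient.mk _ a) = residue A a := fun a => rfl
  have hq : Function.Surjective q := fun y => by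
    obtain ⟨a, rfl⟩ := residue_surjective y
    exact ⟨_, hqmk a⟩
  have hker : RingHom.ker (q : T →+* ResidueField A) = J := by
    ext t
    obtain ⟨a, rfl⟩ := Ideal.Quotient.mk_surjective t
    rw [← pow_one J, hJ 1 a hN, pow_one, RingHom.mem_ker]
    exact residue_eq_zero_iff a
  -- The identity of `k` lifts along `q` because the kernel `J` is nilpotent.
  have : Algebra.FormallyEtale K (ResidueField A) := Algebra.FormallyEtale.of_isSeparable _ _
  let s : ResidueField A →ₐ[K] T := Algebra.FormallySmooth.liftOfSurjective
    (AlgHom.id K (ResidueField A)) q hq ⟨N, by rw [hker]; exact hJN⟩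
  have hs : ∀ y, q (s y) = y := fun y =>
    Algebra.FormallySmooth.liftOfSurjective_apply (AlgHom.id K (ResidueField A)) q hq _ y
  let X : Fin n → T := fun i => Ideal.Quotient.mk _ (x i)
  have hX : ∀ i, X i ∈ J := fun i =>
    Ideal.mem_map_of_mem _ (hx ▸ Ideal.subset_span ⟨i, rfl⟩)
  let ψ : MvPolynomial (Fin n) (ResidueField A) →ₐ[K] T :=
    { MvPolynomial.eval₂Hom (s : ResidueField A →+* T) X with
      commutes' := fun r => by
        change MvPolynomial.eval₂ (s : ResidueField A →+* T) X (algebraMap K _ r) = _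
        rw [MvPolynomial.algebraMap_apply, MvPolynomial.eval₂_C, AlgHom.coe_toRingHom,
          s.commutes] }
  have hψ : ∀ f, ψ f = MvPolynomial.eval₂ (s : ResidueField A →+* T) X f := fun f => rfl
  have hψpow : ∀ d (f : MvPolynomial (Fin n) (ResidueField A)), f.IsHomogeneous d →
    ψ f ∈ J ^ d := fun d f hf => hf.eval₂_mem_pow _ hX
  have hcmp : ∀ d (F : MvPolynomial (Fin n) A), F.IsHomogeneous d →
      ψ (MvPolynomial.map (residue A) F) - Ideal.Quotient.mk _ (MvPolynomial.eval x F) ∈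
        J ^ (d + 1) := fun d F hF => by
    rw [hψ, MvPolynomial.eval₂_map, MvPolynomial.eval₂_comp]
    refine hF.eval₂_sub_eval₂_mem_pow _ _ hX fun a => ?_
    rw [← hker, RingHom.mem_ker, map_sub, sub_eq_zero]
    exact hs _
  have hsurj : Function.Surjective ψ := by
    intro t
    suffices H : ∀ i ≤ N, ∃ f, t - ψ f ∈ J ^ i by
      obtain ⟨f, hf⟩ := H N le_rfl
      rw [hJN] at hf
      exact ⟨f, (sub_eq_zero.mp hf).symm⟩
    intro i
    induction i with
    | zero => exact fun _ => ⟨0, by simp⟩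
    | succ i ih =>
      intro hi
      obtain ⟨f, hf⟩ := ih (by omega)
      obtain ⟨a, ha⟩ := Ideal.Quotient.mk_surjective (t - ψ f)
      rw [← ha, hJ i a (by omega), ← hx, Ideal.mem_span_pow_iff_exists_isHomogeneous] at hf
      obtain ⟨F, hF, rfl⟩ := hf
      refine ⟨f + MvPolynomial.map (residue A) F, ?_⟩
      rw [map_add, ← sub_sub, ← ha, ← neg_sub]
      exact neg_mem (hcmp i F hF)
  refine ⟨n, ⟨ψ, hsurj, fun d f hd hf => ?_, fun f hf d => ?_⟩, q, hqmk, fun f => ?_⟩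
  · have := Ideal.pow_le_pow_right hd (hψpow d f hf)
    rwa [hJN] at this
  -- If `ψ f = 0` and the components below `d` vanish, the image of the component of degree `d` is
  -- minus that of the higher ones, so it lies in `J ^ (d + 1)` and quasi-regularity applies.
  · induction d using Nat.strong_induction_on with
    | _ d ih =>
    intro hd
    obtain ⟨F, hF, hFm⟩ := (MvPolynomial.homogeneousComponent_isHomogeneous d f).exists_map_eq
      (residue_surjective (R := A))
    rw [← hFm]
    refine map_residue_eq_zero_of_eval_mem x hx hn hF ?_
    rw [← hJ (d + 1) _ hd]
    have h1 := hcmp d F hF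
    rw [hFm] at h1
    suffices h2 : ψ (MvPolynomial.homogeneousComponent d f) ∈ J ^ (d + 1) by
      simpa using sub_mem h2 h1
    -- The maximum keeps `d` in the range even when it exceeds the total degree.
    have h3 : f = ∑ i ∈ Finset.range (max f.totalDegree d + 1),
        MvPolynomial.homogeneousComponent i f := by
      conv_lhs => rw [← MvPolynomial.sum_homogeneousComponent f]
      refine Finset.sum_subset (Finset.range_mono (by omega)) fun i _ hi => ?_
      exact MvPolynomial.homogeneousComponent_eq_zero _ _ (by simpa using hi)
    rw [h3, ← Finset.add_sum_erase _ _ (Finset.mem_range.mpr (by omega : d < _)), map_add] at hf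
    rw [eq_neg_of_add_eq_zero_left hf, map_sum]
    refine neg_mem (Ideal.sum_mem _ fun i hi => ?_)
    rcases lt_or_gt_of_ne (Finset.mem_erase.mp hi).1 with h | h
    · rw [ih i h (by omega), map_zero]
      exact zero_mem _
    · exact Ideal.pow_le_pow_right h
        (hψpow i _ (MvPolynomial.homogeneousComponent_isHomogeneous i f))
  · change q (MvPolynomial.eval₂ (s : ResidueField A →+* T) X f) = _
    have hX0 : (fun i => (q : T →+* ResidueField A) (X i)) = 0 := funext fun i => by
      have := hX i
      rwa [← hker, RingHom.mem_ker] at this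
    have h4 := MvPolynomial.eval₂_comp_left (q : T →+* ResidueField A)
      (s : ResidueField A →+* T) X f
    have h5 : (q : T →+* ResidueField A).comp (s : ResidueField A →+* T) = RingHom.id _ :=
      RingHom.ext hs
    rw [h5, Function.comp_def, hX0] at h4
    rw [RingHom.coe_coe] at h4
    rw [h4]
    exact congrFun (congrArg DFunLike.coe MvPolynomial.eval_zero) f

/-! ### Maps from higher differentials to truncated polynomial rings. -/

theorem MvPolynomial.homogeneousComponent_mul {σ A : Type*} [CommRing A] (k : ℕ)
    (p q : MvPolynomial σ A) :
    homogeneousComponent k (p * q) = ∑ i ∈ Finset.range (k + 1),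
      homogeneousComponent i p * homogeneousComponent (k - i) q := by
  classical
  ext e
  rw [coeff_homogeneousComponent, coeff_sum]
  simp_rw [coeff_mul, coeff_homogeneousComponent]
  rw [Finset.sum_comm]
  have h (ab) (hab : ab ∈ Finset.HasAntidiagonal.antidiagonal e) :
      (∑ i ∈ Finset.range (k + 1), (if Finsupp.degree ab.1 = i then coeff ab.1 p else 0) *
        if Finsupp.degree ab.2 = k - i then coeff ab.2 q else 0) =
      if Finsupp.degree e = k then coeff ab.1 p * coeff ab.2 q else 0 := by
    have hdeg : Finsupp.degree ab.1 + Finsupp.degree ab.2 = Finsupp.degree e := by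
      rw [← map_add, Finset.HasAntidiagonal.mem_antidiagonal.mp hab]
    simp_rw [ite_mul, zero_mul]
    rw [Finset.sum_ite_eq]
    simp only [Finset.mem_range, mul_ite, mul_zero]
    split_ifs <;> first | rfl | omega
  rw [Finset.sum_congr rfl h]
  split_ifs
  · rfl
  · rw [Finset.sum_const_zero]

namespace TruncatedPresentation

open HigherDifferential

variable {K k σ T R : Type*} [Field K] [CommRing k] [Algebra K k] [CommRing T] [Algebra K T]
  [CommRing R] [Algebra K R] {N : ℕ}
  (P : TruncatedPresentation K k σ T N) (φ : R →ₐ[K] T) (q : T →+* k)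

/-- A polynomial representing the image of `r` in `T`. -/
noncomputable def rep (r : R) : MvPolynomial σ k := (P.surjective (φ r)).choose

theorem toAlgHom_rep (r : R) : P.toAlgHom (P.rep φ r) = φ r := (P.surjective (φ r)).choose_spec

/-- Makes the grading descend to `T`, so nothing depends on the chosen representatives `rep`. -/
theorem toAlgHom_component_eq {f g : MvPolynomial σ k} (h : P.toAlgHom f = P.toAlgHom g) (d : ℕ) :
    P.toAlgHom (MvPolynomial.homogeneousComponent d f) =
      P.toAlgHom (MvPolynomial.homogeneousComponent d g) := by
  rcases lt_or_ge d N with hd | hd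
  · have := P.component_eq_zero (f - g) (by rw [map_sub, h, sub_self]) d hd
    rw [map_sub, sub_eq_zero] at this
    rw [this]
  · rw [P.map_homogeneous d _ hd (MvPolynomial.homogeneousComponent_isHomogeneous d f),
      P.map_homogeneous d _ hd (MvPolynomial.homogeneousComponent_isHomogeneous d g)]

variable [Algebra R k]

/-- The substitution sending `d⁽ᵏ⁾ r` to the component of degree `k` of a representative
of `r`. -/
noncomputable def substHom : MvPolynomial (ℕ+ × R) R →+* MvPolynomial σ k :=
  -- Scalars go through `k` rather than `φ`: the symbol `d⁽⁰⁾ r` must land in degree zero.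
  MvPolynomial.eval₂Hom (MvPolynomial.C.comp (algebraMap R k))
    fun v => MvPolynomial.homogeneousComponent v.1 (P.rep φ v.2)

variable {q} (hq : ∀ f, q (P.toAlgHom f) = f.constantCoeff) (hφ : ∀ r, q (φ r) = algebraMap R k r)

include hq hφ in
theorem substHom_symb (i : ℕ) (r : R) :
    P.substHom φ (symb i r) = MvPolynomial.homogeneousComponent i (P.rep φ r) := by
  unfold symb substHom
  split_ifs with h
  · simp
  · obtain rfl : i = 0 := by omega
    rw [MvPolynomial.homogeneousComponent_zero, ← MvPolynomial.constantCoeff_eq, ← hq,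
      toAlgHom_rep, hφ]
    simp

theorem isHomogeneous_substHom {p : MvPolynomial (ℕ+ × R) R} {n : ℕ}
    (hp : p.IsWeightedHomogeneous (fun v : ℕ+ × R => (v.1 : ℕ)) n) :
    (P.substHom φ p).IsHomogeneous n := by
  rw [substHom, MvPolynomial.coe_eval₂Hom]
  rw [MvPolynomial.eval₂_eq]
  refine MvPolynomial.IsHomogeneous.sum _ _ _ fun e he => ?_
  rw [← zero_add n]
  refine MvPolynomial.IsHomogeneous.mul (MvPolynomial.isHomogeneous_C _ _) ?_
  rw [← hp (MvPolynomial.mem_support_iff.mp he), Finsupp.weight_apply]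
  refine MvPolynomial.IsHomogeneous.prod _ _ _ fun v _ => ?_
  change MvPolynomial.IsHomogeneous _ (e v * v.1)
  rw [mul_comm]
  exact (MvPolynomial.homogeneousComponent_isHomogeneous _ _).pow _

include hq hφ in
theorem toAlgHom_substHom_relations (p : MvPolynomial (ℕ+ × R) R) (hp : p ∈ relations K R) :
    P.toAlgHom (P.substHom φ p) = 0 := by
  have hle : relations K R ≤
      RingHom.ker ((P.toAlgHom : MvPolynomial σ k →+* T).comp (P.substHom φ)) := by
    refine Ideal.span_le.mpr ?_
    rintro p ((⟨k, r, s, hk, rfl⟩ | ⟨k, a, hk, rfl⟩) | ⟨k, r, s, hk, rfl⟩)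
    · simp only [SetLike.mem_coe, RingHom.mem_ker, RingHom.comp_apply, map_sub,
        P.substHom_symb φ hq hφ, RingHom.coe_coe]
      rw [P.toAlgHom_component_eq (g := P.rep φ r + P.rep φ s)
        (by simp only [map_add, toAlgHom_rep])]
      simp only [map_add]
      ring
    · simp only [SetLike.mem_coe, RingHom.mem_ker, RingHom.comp_apply,
        P.substHom_symb φ hq hφ, RingHom.coe_coe]
      rw [P.toAlgHom_component_eq (g := algebraMap K _ a)
        (by rw [toAlgHom_rep, AlgHom.commutes, AlgHom.commutes]),
        MvPolynomial.algebraMap_apply,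
        MvPolynomial.homogeneousComponent_of_mem (MvPolynomial.isHomogeneous_C σ _),
        if_neg hk.ne', map_zero]
    · simp only [SetLike.mem_coe, RingHom.mem_ker, RingHom.comp_apply, map_sub, map_sum,
        map_mul, P.substHom_symb φ hq hφ, RingHom.coe_coe]
      rw [P.toAlgHom_component_eq (g := P.rep φ r * P.rep φ s)
        (by simp only [map_mul, toAlgHom_rep]), MvPolynomial.homogeneousComponent_mul]
      simp only [map_sum, map_mul, sub_self]
  exact hle hp

/-- The homomorphism `G / I → T` induced by the substitution. -/
noncomputable def gradedHom : GradedDif K R →+* T :=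
  Ideal.Quotient.lift (relations K R)
    ((P.toAlgHom : MvPolynomial σ k →+* T).comp (P.substHom φ))
    (P.toAlgHom_substHom_relations φ hq hφ)

theorem gradedHom_toGradedDif (p : MvPolynomial (ℕ+ × R) R) :
    P.gradedHom φ hq hφ (toGradedDif K R p) = P.toAlgHom (P.substHom φ p) := rfl

theorem gradedHom_filtration (x : GradedDif K R) (hx : x ∈ filtration K R N) :
    P.gradedHom φ hq hφ x = 0 := by
  have hle : filtration K R N ≤ RingHom.ker (P.gradedHom φ hq hφ) := by
    refine Ideal.span_le.mpr ?_
    rintro _ ⟨n, hn, p, hp, rfl⟩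
    exact P.map_homogeneous n _ hn (P.isHomogeneous_substHom φ hp)
  exact hle hx

theorem gradedHom_dPartial (r : R) : P.gradedHom φ hq hφ (dPartial K N r) = φ r := by
  have h1 : P.gradedHom φ hq hφ (dPartial K N r) = ∑ i ∈ Finset.range N,
      P.toAlgHom (MvPolynomial.homogeneousComponent i (P.rep φ r)) := by
    rw [dPartial, map_sum]
    refine Finset.sum_congr rfl fun i _ => ?_
    rw [cls, gradedHom_toGradedDif, P.substHom_symb φ hq hφ]
  have h2 : P.rep φ r = ∑ i ∈ Finset.range (max ((P.rep φ r).totalDegree + 1) N),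
      MvPolynomial.homogeneousComponent i (P.rep φ r) := by
    conv_lhs => rw [← MvPolynomial.sum_homogeneousComponent (P.rep φ r)]
    refine Finset.sum_subset (Finset.range_mono (le_max_left _ _)) fun i _ hi => ?_
    exact MvPolynomial.homogeneousComponent_eq_zero _ _ (by simpa using hi)
  rw [h1, ← P.toAlgHom_rep φ r]
  conv_rhs => rw [h2, map_sum]
  refine Finset.sum_subset (Finset.range_mono (le_max_right _ _)) fun i _ hi => ?_
  exact P.map_homogeneous i _ (by simpa using hi)
    (MvPolynomial.homogeneousComponent_isHomogeneous _ _)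

theorem q_gradedHom (x : GradedDif K R) :
    q (P.gradedHom φ hq hφ x) = algebraMap R k (gradedAug K R x) := by
  obtain ⟨p, rfl⟩ := Ideal.Quotient.mk_surjective x
  change q (P.toAlgHom (P.substHom φ p)) =
    algebraMap R k (MvPolynomial.aeval (fun _ : ℕ+ × R => (0 : R)) p)
  rw [hq]
  have : MvPolynomial.constantCoeff.comp (P.substHom φ) = (algebraMap R k).comp
      (MvPolynomial.aeval (fun _ : ℕ+ × R => (0 : R)) : MvPolynomial (ℕ+ × R) R →ₐ[R] R) := by
    refine MvPolynomial.ringHom_ext (fun r => ?_) fun v => ?_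
    · simp [substHom]
    · have hv : ¬ (0 : ℕ) = v.1 := v.1.pos.ne
      simp [substHom, MvPolynomial.constantCoeff_eq, MvPolynomial.coeff_homogeneousComponent, hv]
  exact RingHom.congr_fun this p

/-- The homomorphism `Dif_{R/K} → T` through which `φ` factors along `d_R`. -/
noncomputable def difHom : Dif K R →+* T :=
  ((Ideal.Quotient.lift (filtration K R N) (P.gradedHom φ hq hφ)
    (P.gradedHom_filtration φ hq hφ)).comp
    (Pi.evalRingHom (fun k : ℕ => GradedDif K R ⧸ filtration K R k) N)).comp
    (difSubalgebra K R).val.toRingHom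

theorem difHom_d (r : R) : P.difHom φ hq hφ (d K R r) = φ r :=
  P.gradedHom_dPartial φ hq hφ r

theorem difHom_algebraMap (r : R) :
    P.difHom φ hq hφ (algebraMap R (Dif K R) r) =
      P.toAlgHom (MvPolynomial.C (algebraMap R k r)) := by
  change P.toAlgHom (P.substHom φ (MvPolynomial.C r)) = _
  simp [substHom]

theorem q_difHom (hN : 0 < N) (x : Dif K R) :
    q (P.difHom φ hq hφ x) = algebraMap R k (aug K R x) := by
  obtain ⟨x, hx⟩ := x
  obtain ⟨g, hg⟩ := Ideal.Quotient.mk_surjective (x N)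
  -- The augmentation reads level `1` of the completion and `difHom` reads level `N`; compatibility
  -- gives both the same representative `g`.
  have h1 : x 1 = Ideal.Quotient.mk _ g := by
    rw [← hx 1 N hN, ← hg, Ideal.Quotient.factor_mk]
  change q (Ideal.Quotient.lift (filtration K R N) (P.gradedHom φ hq hφ)
    (P.gradedHom_filtration φ hq hφ) (x N)) = algebraMap R k
      (Ideal.Quotient.liftₐ (filtration K R 1) (gradedAug K R) (gradedAug_filtration K R) (x 1))
  rw [h1, ← hg]
  exact P.q_gradedHom φ hq hφ g

variable {M : Type*} [AddCommGroup M] [Module R M]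

include hq hφ in
/-- A connection on `M` transports a linear functional on `M` with values in `k` to a
`φ`-semilinear map with values in `T`. -/
theorem exists_semilinear_lift (hN : 0 < N) (c : HigherConnection K R M) (l : M →ₗ[R] k) :
    ∃ L : M →+ T, (∀ (r : R) m, L (r • m) = φ r * L m) ∧ ∀ m, q (L m) = l m := by
  let γ := P.difHom φ hq hφ
  let δ : k →+* T := (P.toAlgHom : MvPolynomial σ k →+* T).comp MvPolynomial.C
  -- The balancing condition holds because `γ` restricted to `R` factors through `k`, where `l` is
  -- linear.
  let u : Dif K R ⊗[R] M →+ T := TensorProduct.liftAddHom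
    (AddMonoidHom.mk' (fun x => (AddMonoidHom.mulLeft (γ x)).comp
      (δ.toAddMonoidHom.comp l.toAddMonoidHom)) fun x y => by
        ext m
        simp [add_mul]) fun r x m => by
      change γ (r • x) * δ (l m) = γ x * δ (l (r • m))
      rw [Algebra.smul_def, map_mul, map_smul, Algebra.smul_def, map_mul]
      rw [show γ (algebraMap R (Dif K R) r) = δ (algebraMap R k r) from
        P.difHom_algebraMap φ hq hφ r]
      ring
  have hu : ∀ x m, u (x ⊗ₜ[R] m) = γ x * δ (l m) := fun x m => rfl
  have husmul : ∀ (x : Dif K R) (z : Dif K R ⊗[R] M), u (x • z) = γ x * u z := by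
    intro x z
    induction z with
    | zero => simp
    | tmul y m => rw [TensorProduct.smul_tmul', hu, hu, smul_eq_mul, map_mul, mul_assoc]
    | add a b ha hb => rw [smul_add, map_add, map_add, ha, hb, mul_add]
  have hqδ : ∀ y, q (δ y) = y := fun y => by
    rw [show δ y = P.toAlgHom (MvPolynomial.C y) from rfl, hq, MvPolynomial.constantCoeff_C]
  let v : R ⊗[R] M →ₗ[R] k := l ∘ₗ (TensorProduct.lid R M).toLinearMap
  have hqu : ∀ z, q (u z) = v ((aug K R).toLinearMap.rTensor M z) := by
    intro z
    induction z with
    | zero => simp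
    | tmul y m =>
      rw [hu, map_mul, hqδ, LinearMap.rTensor_tmul, P.q_difHom φ hq hφ hN]
      simp [v, Algebra.smul_def]
    | add a b ha hb => rw [map_add, map_add, map_add, map_add, ha, hb]
  refine ⟨u.comp c.toAddHom, fun r m => ?_, fun m => ?_⟩
  · rw [AddMonoidHom.comp_apply, c.map_smul, husmul, P.difHom_d]
    rfl
  · rw [AddMonoidHom.comp_apply, hqu, c.aug_apply]
    simp [v]

end TruncatedPresentation

/-! ### Freeness over regular local rings and the global statement. -/

namespace HigherDifferential

open IsLocalRing

/-- If a finitely generated module carries a higher connection, then its base change to any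
regular local algebra with separable residue field is free. -/
theorem HigherConnection.free_baseChange {K R A M : Type*} [Field K] [CommRing R] [Algebra K R]
    [CommRing A] [Algebra K A] [Algebra R A] [IsScalarTower K R A] [IsRegularLocalRing A]
    [Algebra.IsSeparable K (ResidueField A)] [AddCommGroup M] [Module R M] [Module.Finite R M]
    (c : HigherConnection K R M) : Module.Free A (A ⊗[R] M) := by
  classical
  let k := ResidueField A
  -- The basis is extracted from pure tensors `1 ⊗ m`, so that the lifted functionals on `M` can be
  -- evaluated on its members.
  obtain ⟨S, hS, hspan, hli⟩ :=
    exists_linearIndependent k (Set.range fun m : M => (1 : k) ⊗ₜ[R] m)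
  have htop : Submodule.span k (Set.range fun m : M => (1 : k) ⊗ₜ[R] m) = ⊤ := by
    refine eq_top_iff.mpr fun z _ => ?_
    induction z with
    | zero => exact zero_mem _
    | tmul x m =>
      rw [← mul_one x, ← smul_eq_mul, ← TensorProduct.smul_tmul']
      exact Submodule.smul_mem _ _ (Submodule.subset_span ⟨m, rfl⟩)
    | add a b ha hb => exact add_mem (ha trivial) (hb trivial)
  let B : Module.Basis S k (k ⊗[R] M) := Module.Basis.mk hli (by
    rw [Subtype.range_coe, hspan, htop])
  have hfin : Finite S := Module.Finite.finite_basis B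
  have := Fintype.ofFinite S
  choose m hm using fun i : S => hS i.2
  have hB : ∀ i, (1 : k) ⊗ₜ[R] m i = B i := fun i => by
    rw [Module.Basis.mk_apply]
    exact hm i
  let f : S → A ⊗[R] M := fun i => 1 ⊗ₜ m i
  have hfspan : Submodule.span A (Set.range f) = ⊤ := by
    refine span_eq_top_of_tmul_eq_basis f
      (B.map (TensorProduct.AlgebraTensorModule.cancelBaseChange R A k k M).symm) fun i => ?_
    rw [Module.Basis.map_apply, ← hB]
    simp [f]
  let l : S → M →ₗ[R] k := fun j =>
    ((B.coord j).restrictScalars R) ∘ₗ TensorProduct.mk R k M 1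
  have hl : ∀ i j, l j (m i) = if i = j then 1 else 0 := fun i j => by
    change B.coord j ((1 : k) ⊗ₜ[R] m i) = _
    rw [hB, Module.Basis.coord_apply, Module.Basis.repr_self, Finsupp.single_apply]
  have hfli : LinearIndependent A f := by
    rw [Fintype.linearIndependent_iff]
    intro a ha
    -- Krull's intersection theorem reduces the vanishing of the coefficients to each truncation.
    suffices H : ∀ N, 0 < N → ∀ i, a i ∈ maximalIdeal A ^ N by
      intro i
      have : a i ∈ ⨅ N : ℕ, maximalIdeal A ^ N := by
        refine Ideal.mem_iInf.mpr fun N => ?_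
        exact Ideal.pow_le_pow_right N.le_succ (H (N + 1) N.succ_pos i)
      rwa [Ideal.iInf_pow_eq_bot_of_isLocalRing _ (maximalIdeal.isMaximal A).ne_top] at this
    intro N hN
    obtain ⟨n, P, q, hqmk, hq⟩ := IsRegularLocalRing.exists_truncatedPresentation K A N hN
    let T := A ⧸ maximalIdeal A ^ N
    let π : A →+* T := Ideal.Quotient.mk _
    let φ : R →ₐ[K] T := (Ideal.Quotient.mkₐ K (maximalIdeal A ^ N)).comp
      (IsScalarTower.toAlgHom K R A)
    have hφ : ∀ r, φ r = π (algebraMap R A r) := fun r => rfl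
    choose L hL hqL using fun j => P.exists_semilinear_lift (q := (q : T →+* k)) φ hq
      (fun r => hqmk _) hN c (l j)
    let G : Matrix S S T := fun i j => L j (m i)
    have hG : IsUnit G := by
      rw [Matrix.isUnit_iff_isUnit_det]
      obtain ⟨b, hb⟩ := Ideal.Quotient.mk_surjective G.det
      have h1 : residue A b = 1 := by
        rw [← hqmk, hb]
        change (q : T →+* k) G.det = 1
        rw [RingHom.map_det, show (q : T →+* k).mapMatrix G = 1 from ?_, Matrix.det_one]
        ext i j
        rw [Matrix.one_apply, ← hl]
        exact hqL j (m i)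
      rw [← hb]
      refine IsUnit.map _ ((residue_ne_zero_iff_isUnit b).mp ?_)
      rw [h1]
      exact one_ne_zero
    have hvec : Matrix.vecMul (fun i => π (a i)) G = 0 := by
      funext j
      -- Semilinearity of `L j` extends it to `A ⊗ M`; applied to the relation `ha`, it gives column
      -- `j` of the matrix equation.
      let u : A ⊗[R] M →+ T := TensorProduct.liftAddHom
        (AddMonoidHom.mk' (fun x => (AddMonoidHom.mulLeft (π x)).comp (L j)) fun x y => by
            ext z
            simp [add_mul]) fun r x z => by
          change π (r • x) * L j z = π x * L j (r • z)
          rw [Algebra.smul_def, map_mul, hL, hφ]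
          ring
      have hu : ∀ x z, u (x ⊗ₜ[R] z) = π x * L j z := fun x z => rfl
      have := congrArg u ha
      rw [map_sum, map_zero] at this
      rw [Pi.zero_apply, ← this]
      refine Finset.sum_congr rfl fun i _ => ?_
      rw [TensorProduct.smul_tmul', hu, smul_eq_mul, mul_one]
    have h0 := Matrix.vecMul_injective_of_isUnit hG
      (hvec.trans (Matrix.zero_vecMul G).symm)
    exact fun i => Ideal.Quotient.eq_zero_iff_mem.mp (congrFun h0 i)
  exact Module.Free.of_basis (Module.Basis.mk hfli hfspan.ge)

/-- By Zariski's lemma the residue field is finite over `K`, hence separable as `K` is perfect. -/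
theorem isSeparable_residueField_atPrime (K R : Type*) [Field K] [PerfectField K] [CommRing R]
    [Algebra K R] [Algebra.FiniteType K R] (I : Ideal R) [I.IsMaximal] :
    Algebra.IsSeparable K (ResidueField (Localization.AtPrime I)) := by
  let k := ResidueField (Localization.AtPrime I)
  have hsurj : Function.Surjective (IsScalarTower.toAlgHom K R k) := by
    intro y
    obtain ⟨z, rfl⟩ := I.bijective_algebraMap_quotient_residueField.2 y
    obtain ⟨r, rfl⟩ := Ideal.Quotient.mk_surjective z
    exact ⟨r, rfl⟩
  have : Algebra.FiniteType K k := Algebra.FiniteType.of_surjective _ hsurj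
  have : Module.Finite K k := finite_of_finite_type_of_isJacobsonRing K k
  infer_instance

end HigherDifferential

theorem corollary4p4 (K : Type*) [Field K] [PerfectField K] :
    (∀ (R : Type*) [CommRing R] [Algebra K R] [Algebra.FiniteType K R] [IsRegularRing R]
        (M : Type*) [AddCommGroup M] [Module R M] [Module.Finite R M],
        Nonempty (HigherDifferential.HigherConnection K R M) → Module.Projective R M) ∧
    (∀ (R : Type*) [CommRing R] [Algebra K R] [Algebra.EssFiniteType K R] [IsRegularLocalRing R]
        [Module.Finite K (IsLocalRing.ResidueField R)]
        [Algebra.IsSeparable K (IsLocalRing.ResidueField R)]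
        (M : Type*) [AddCommGroup M] [Module R M] [Module.Finite R M],
        Nonempty (HigherDifferential.HigherConnection K R M) → Module.Free R M) := by
  refine ⟨?_, ?_⟩
  · rintro R _ _ _ _ M _ _ _ ⟨c⟩
    have : Module.FinitePresentation R M := Module.finitePresentation_of_finite R M
    -- Finite presentation lets projectivity be checked at maximal ideals, where the localisations
    -- are regular local.
    refine Module.projective_of_localization_maximal fun I hI => ?_
    have := HigherDifferential.isSeparable_residueField_atPrime K R I
    have := c.free_baseChange (A := Localization.AtPrime I)
    have := Module.Projective.of_free (R := Localization.AtPrime I)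
      (P := Localization.AtPrime I ⊗[R] M)
    exact Module.Projective.of_equiv (LocalizedModule.equivTensorProduct I.primeCompl M).symm
  · rintro R _ _ _ _ _ _ M _ _ _ ⟨c⟩
    have := c.free_baseChange (A := R)
    exact Module.Free.of_equiv (TensorProduct.lid R M)
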